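/- Let $M=\mathbb S^1=\mathbb R/\mathbb Z$ with the Euclidean metric, and let $L=\frac12\frac{d^2}{dx^2}$, acting on $C^2(M)$. For $x\in M$ let $\mathbb P_x$ be the law, on the space $\mathcal C$ of continuous paths $w:[0,\infty)\to M$, of Brownian motion on $M$ started at $x$, i.e. of the diffusion with infinitesimal generator $L$ and $X_0=x$ (the solution of the martingale problem for $L$ started at $x$). Let $\mu$ be a finite Borel measure on $M$ such that $L$ is selfadjoint in $L^2(\mu)$, in the sense that $$\int_M (Lf)\,g\,d\mu=\int_M f\,(Lg)\,d\mu\qquad\text{for all } f,g\in C^2(M),$$ and let $\mathbb P_\mu=\int_M\mathbb P_x\,d\mu(x)$ be the path measure with initial measure $\mu$. Let $V:M\to\mathbb R$ be Lipschitz. Then for every $t\ge 0$ and all continuous $f,g:M\to\mathbb R$, $$\int_{\mathcal C}e^{\int_0^t V(w(r))\,dr}f(w(t))\,g(w(0))\,d\mathbb P_\mu(w)=\int_{\mathcal C}e^{\int_0^t V(w(r))\,dr}f(w(0))\,g(w(t))\,d\mathbb P_\mu(w),$$ and both integrands are $\mathbb P_\mu$-integrable. -/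

import Mathlib

open MeasureTheory ProbabilityTheory
open scoped NNReal

noncomputable section

/-- `f` is of class `C²` on the circle `ℝ / ℤ`: its `1`-periodic lift to `ℝ` is `C²`. -/
def CircleC2 (f : UnitAddCircle → ℝ) : Prop :=
  ContDiff ℝ 2 fun s : ℝ => f (s : UnitAddCircle)

/-- The operator `L = (1/2) d²/dx²` on the circle `ℝ / ℤ`; used on `C²` functions only. -/
def circleGenerator (f : UnitAddCircle → ℝ) (x : UnitAddCircle) : ℝ :=
  (1 / 2) * iteratedDeriv 2 (fun s : ℝ => f (x + (s : UnitAddCircle))) 0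

/-- The space of continuous paths `w : [0, ∞) → ℝ / ℤ`. Its σ-algebra (from the subtype and product
instances) is the one generated by the coordinate maps `w ↦ w t`. -/
abbrev CirclePath : Type := {w : ℝ≥0 → UnitAddCircle // Continuous w}

/-- The coordinate process on path space, `X t w = w t`. -/
def coordProcess (t : ℝ≥0) (w : CirclePath) : UnitAddCircle := w.1 t

theorem stronglyMeasurable_coordProcess (t : ℝ≥0) : StronglyMeasurable (coordProcess t) :=
  ((measurable_pi_apply t).comp measurable_subtype_coe).stronglyMeasurable

/-- The filtration `t ↦ σ(X s, s ≤ t)` generated by the coordinate process. -/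
def pathFiltration : Filtration ℝ≥0 (inferInstance : MeasurableSpace CirclePath) :=
  Filtration.natural coordProcess stronglyMeasurable_coordProcess

/-- The integral `∫₀ᵗ V (w r) dr` along a path. -/
def pathIntegral (V : UnitAddCircle → ℝ) (t : ℝ≥0) (w : CirclePath) : ℝ :=
  ∫ r in (0 : ℝ)..(t : ℝ), V (coordProcess r.toNNReal w)

/-- `Q` is the law on path space of Brownian motion on the circle started at `x`, that is, of the
diffusion with infinitesimal generator `L = (1/2) d²/dx²` started at `x`: it solves the martingale
problem for `L` on `C²` functions. -/
structure IsCircleBrownianLaw (x : UnitAddCircle) (Q : Measure CirclePath) : Prop where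
  isProbabilityMeasure : IsProbabilityMeasure Q
  start : ∀ᵐ w ∂Q, coordProcess 0 w = x
  martingale : ∀ f : UnitAddCircle → ℝ, CircleC2 f →
    Martingale (fun (t : ℝ≥0) (w : CirclePath) =>
      f (coordProcess t w) - f (coordProcess 0 w) - pathIntegral (circleGenerator f) t w)
      pathFiltration Q

/-- `L` is selfadjoint in `L²(μ)`: `∫ (L f) g dμ = ∫ f (L g) dμ` for all `f`, `g` in the domain
`C²` of `L`. -/
def GeneratorSelfAdjoint (μ : Measure UnitAddCircle) : Prop :=
  ∀ f g : UnitAddCircle → ℝ, CircleC2 f → CircleC2 g →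
    ∫ x, circleGenerator f x * g x ∂μ = ∫ x, f x * circleGenerator g x ∂μ

end

/-!
The Feynman–Kac weight `exp (∫₀ᵗ V (w r) dr)` is unchanged when a path is reversed on `[0, t]`, and
Brownian motion started from `μ` is reversible because its generator `L` is symmetric in `L²(μ)`.
Both facts are used in discretised form.

* The functions `x ↦ Re (a e^{2πinx})` are eigenfunctions of `L` and span a dense subspace of
  `C(ℝ/ℤ)` (`dense_span_generatorEigenfunction`), so identities between continuous functionals need
  only be checked on eigenfunctions.
* If `L c = -lam • c`, the martingale problem turns `u r = E[c(X_r) Z]`, for a bounded weight `Z`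
  from the past, into a solution of `u' = -lam u`
  (`IsCircleBrownianLaw.integral_eigenfunction`). By density this gives the Feller property, hence
  the transition operators `A` on `C(ℝ/ℤ)` (`transition`), and the Markov property
  (`integral_coordProcess_add_mul`).
* Eigenfunctions of `L` for different eigenvalues are orthogonal in `L²(μ)`, so `A` is symmetric in
  `L²(μ)` (`integral_transition_mul`).
* Let `h = t / N` and let `M` be multiplication by `exp (h V)`. By the Markov property the expectation
  of `exp (h ∑_{k ≤ N} V(X_{kh})) f(X_t) g(X_0)` under the path measure is
  `∫ g · (M A)^N M f dμ` (`integral_prod_coordProcess`), which is symmetric in `f` and `g` since `A`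
  and `M` are (`integral_mul_iterate_weightedStep`).
* As `N → ∞` the Riemann sums converge to the path integral (`tendsto_pathRiemannSum`), and
  dominated convergence gives the claim.
-/

/-! ### Eigenfunctions of the generator -/

/-- The continuous function `c` is a `C²` eigenfunction of `L` with `L c = -lam • c`. -/
def IsGeneratorEigenfunction (lam : ℝ) (c : C(UnitAddCircle, ℝ)) : Prop :=
  CircleC2 c ∧ ∀ x, circleGenerator c x = -lam * c x

/-- The real trigonometric monomial `x ↦ Re (a e^{2πinx})`; a complex amplitude `a` covers the
cosine, the sine and all their real combinations at frequency `n`. -/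
noncomputable def reFourier (a : ℂ) (n : ℤ) : C(UnitAddCircle, ℝ) where
  toFun x := (a * fourier n x).re
  continuous_toFun := Complex.continuous_re.comp (continuous_const.mul (fourier n).continuous)

theorem reFourier_coe_add (a : ℂ) (n : ℤ) (x : UnitAddCircle) (s : ℝ) :
    reFourier a n (x + (s : UnitAddCircle)) =
      (a * fourier n x * Complex.exp (2 * Real.pi * Complex.I * n * s)).re := by
  have h : fourier n (s : UnitAddCircle) = Complex.exp (2 * Real.pi * Complex.I * n * s) := by
    rw [fourier_coe_apply]; simp
  have h2 : fourier n (x + (s : UnitAddCircle)) = fourier n x * fourier n (s : UnitAddCircle) := by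
    simp only [fourier_apply, smul_add, AddCircle.toCircle_add, Circle.coe_mul]
  change (a * fourier n (x + (s : UnitAddCircle))).re = _
  rw [h2, h, ← mul_assoc a]

theorem deriv_re_mul_cexp (b k : ℂ) :
    deriv (fun s : ℝ => (b * Complex.exp (k * s)).re) =
      fun s : ℝ => (b * k * Complex.exp (k * s)).re := by
  funext s
  have h1 : HasDerivAt (fun s : ℝ => k * (s : ℂ)) k s := by
    simpa using (Complex.ofRealCLM.hasDerivAt (x := s)).const_mul k
  have h2 := (h1.cexp).const_mul b
  have h3 := Complex.reCLM.hasFDerivAt.comp_hasDerivAt s h2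
  refine h3.deriv.trans ?_
  simp only [Complex.reCLM_apply]
  congr 1
  ring

theorem isGeneratorEigenfunction_reFourier (a : ℂ) (n : ℤ) :
    IsGeneratorEigenfunction (2 * Real.pi ^ 2 * n ^ 2) (reFourier a n) := by
  constructor
  · have h : (fun s : ℝ => reFourier a n (s : UnitAddCircle)) = fun s : ℝ =>
        (a * fourier n (0 : UnitAddCircle) *
          Complex.exp (2 * Real.pi * Complex.I * n * s)).re := by
      funext s
      rw [← reFourier_coe_add, zero_add]
    unfold CircleC2
    rw [h]
    refine Complex.reCLM.contDiff.comp (contDiff_const.mul (Complex.contDiff_exp.comp ?_))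
    exact contDiff_const.mul Complex.ofRealCLM.contDiff
  · intro x
    have h0 : reFourier a n x = (a * fourier n x).re := rfl
    unfold circleGenerator
    simp_rw [reFourier_coe_add]
    rw [iteratedDeriv_succ, iteratedDeriv_one, deriv_re_mul_cexp, deriv_re_mul_cexp, h0]
    have : a * fourier n x * (2 * Real.pi * Complex.I * n) * (2 * Real.pi * Complex.I * n)
        = ((-(4 * Real.pi ^ 2 * n ^ 2) : ℝ) : ℂ) * (a * fourier n x) := by
      push_cast
      linear_combination (4 * a * fourier n x * Real.pi ^ 2 * n ^ 2) * Complex.I_sq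
    rw [this]
    simp only [Complex.ofReal_zero, mul_zero, Complex.exp_zero, mul_one, Complex.re_ofReal_mul]
    ring

/-- The linear span of the eigenfunctions of the generator is uniformly dense in the continuous
functions on the circle. -/
theorem dense_span_generatorEigenfunction :
    Dense (Submodule.span ℝ {c | ∃ lam, IsGeneratorEigenfunction lam c} :
      Set C(UnitAddCircle, ℝ)) := by
  set E := Submodule.span ℝ {c : C(UnitAddCircle, ℝ) | ∃ lam, IsGeneratorEigenfunction lam c}
  have key : ∀ p ∈ Submodule.span ℂ (Set.range (fourier (T := 1))), ∀ a : ℂ,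
      (⟨fun x => (a * p x).re, by fun_prop⟩ : C(UnitAddCircle, ℝ)) ∈ E := by
    intro p hp
    induction hp using Submodule.span_induction with
    | mem p hp =>
      obtain ⟨n, rfl⟩ := hp
      exact fun a => Submodule.subset_span ⟨_, isGeneratorEigenfunction_reFourier a n⟩
    | zero =>
      intro a
      convert E.zero_mem using 1
      ext x
      simp
    | add p q _ _ hp hq =>
      intro a
      convert E.add_mem (hp a) (hq a) using 1
      ext x
      simp [mul_add]
    | smul b p _ hp =>
      intro a
      convert hp (a * b) using 1
      ext x
      simp [mul_assoc]
  refine Metric.dense_iff.2 fun φ ε hε => ?_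
  have hd : Dense (Submodule.span ℂ (Set.range (fourier (T := 1))) : Set C(UnitAddCircle, ℂ)) :=
    Submodule.dense_iff_topologicalClosure_eq_top.2 span_fourier_closure_eq_top
  obtain ⟨p, hpφ, hp⟩ := Metric.dense_iff.1 hd
    (⟨fun x => (φ x : ℂ), by fun_prop⟩ : C(UnitAddCircle, ℂ)) ε hε
  refine ⟨_, ?_, key p hp 1⟩
  rw [Metric.mem_ball, ContinuousMap.dist_lt_iff hε] at hpφ ⊢
  intro x
  refine lt_of_le_of_lt ?_ (hpφ x)
  simpa [dist_eq_norm] using Complex.abs_re_le_norm (p x - φ x)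

/-- Continuous linear functionals on `C(ℝ/ℤ)` are determined by the eigenfunctions of the
generator. -/
theorem ContinuousLinearMap.ext_generatorEigenfunction {T U : C(UnitAddCircle, ℝ) →L[ℝ] ℝ}
    (h : ∀ lam c, IsGeneratorEigenfunction lam c → T c = U c) : T = U :=
  ContinuousLinearMap.ext_on dense_span_generatorEigenfunction fun c ⟨lam, hc⟩ => h lam c hc

/-! ### Weighted expectations as functionals -/

theorem integrable_comp_mul {Ω : Type*} [MeasurableSpace Ω] {Q : Measure Ω}
    {X : Ω → UnitAddCircle} (hX : Measurable X) {Z : Ω → ℝ} (hZ : Integrable Z Q)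
    (φ : C(UnitAddCircle, ℝ)) : Integrable (fun ω => φ (X ω) * Z ω) Q :=
  hZ.bdd_mul (c := ‖φ‖) (φ.continuous.measurable.comp hX).aestronglyMeasurable
    (Filter.Eventually.of_forall fun ω => φ.norm_coe_le_norm (X ω))

/-- The functional `φ ↦ E[φ(X) Z]` on continuous functions on the circle, for an integrable
weight `Z`. -/
noncomputable def weightedExpectation {Ω : Type*} [MeasurableSpace Ω] (Q : Measure Ω)
    (X : Ω → UnitAddCircle) (hX : Measurable X) (Z : Ω → ℝ) (hZ : Integrable Z Q) :
    C(UnitAddCircle, ℝ) →L[ℝ] ℝ :=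
  LinearMap.mkContinuous
    { toFun := fun φ => ∫ ω, φ (X ω) * Z ω ∂Q
      map_add' := fun φ ψ => by
        simp only [ContinuousMap.add_apply, add_mul]
        exact integral_add (integrable_comp_mul hX hZ φ) (integrable_comp_mul hX hZ ψ)
      map_smul' := fun a φ => by
        simp only [ContinuousMap.smul_apply, smul_eq_mul, mul_assoc, RingHom.id_apply]
        exact integral_const_mul _ _ }
    (∫ ω, ‖Z ω‖ ∂Q) fun φ => by
      refine (norm_integral_le_integral_norm _).trans ?_
      rw [mul_comm, ← integral_const_mul]
      refine integral_mono (integrable_comp_mul hX hZ φ).norm (hZ.norm.const_mul _) fun ω => ?_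
      simp only [norm_mul]
      gcongr
      exact φ.norm_coe_le_norm _

@[simp]
theorem weightedExpectation_apply {Ω : Type*} [MeasurableSpace Ω] (Q : Measure Ω)
    (X : Ω → UnitAddCircle) (hX : Measurable X) (Z : Ω → ℝ) (hZ : Integrable Z Q)
    (φ : C(UnitAddCircle, ℝ)) :
    weightedExpectation Q X hX Z hZ φ = ∫ ω, φ (X ω) * Z ω ∂Q := rfl

/-! ### Coordinates and path integrals -/

theorem measurable_coordProcess (t : ℝ≥0) : Measurable (coordProcess t) :=
  (stronglyMeasurable_coordProcess t).measurable

theorem continuous_coordProcess_toNNReal (w : CirclePath) :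
    Continuous fun r : ℝ => coordProcess r.toNNReal w :=
  w.2.comp continuous_real_toNNReal

theorem intervalIntegrable_coordProcess (φ : C(UnitAddCircle, ℝ)) (w : CirclePath) (a b : ℝ) :
    IntervalIntegrable (fun r : ℝ => φ (coordProcess r.toNNReal w)) volume a b :=
  (φ.continuous.comp (continuous_coordProcess_toNNReal w)).intervalIntegrable a b

theorem stronglyMeasurable_uncurry_coordProcess (φ : C(UnitAddCircle, ℝ)) :
    StronglyMeasurable fun p : ℝ × CirclePath => φ (coordProcess p.1.toNNReal p.2) := by
  have := measurable_uncurry_of_continuous_of_measurable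
    (u := fun (r : ℝ) (w : CirclePath) => φ (coordProcess r.toNNReal w))
    (fun w => φ.continuous.comp (continuous_coordProcess_toNNReal w))
    fun r => φ.continuous.measurable.comp (measurable_coordProcess _)
  exact this.stronglyMeasurable

theorem stronglyMeasurable_pathFiltration_comp {s t : ℝ≥0} (hst : s ≤ t)
    (φ : C(UnitAddCircle, ℝ)) :
    StronglyMeasurable[pathFiltration t] fun w => φ (coordProcess s w) :=
  φ.continuous.comp_stronglyMeasurable
    ((Filtration.stronglyAdapted_natural stronglyMeasurable_coordProcess s).mono
      (pathFiltration.mono hst))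

/-! ### Decay of eigenfunctions under the martingale problem -/

theorem MeasureTheory.Martingale.integral_mul_eq {Ω ι : Type*} [Preorder ι] {mΩ : MeasurableSpace Ω}
    {Q : Measure Ω} [IsFiniteMeasure Q] {ℱ : Filtration ι mΩ} {M : ι → Ω → ℝ}
    (hM : Martingale M ℱ Q) {s t : ι} (hst : s ≤ t) {Z : Ω → ℝ} (hZ : StronglyMeasurable[ℱ s] Z)
    {C : ℝ} (hC : ∀ ω, ‖Z ω‖ ≤ C) : ∫ ω, Z ω * M t ω ∂Q = ∫ ω, Z ω * M s ω ∂Q := by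
  have h := condExp_stronglyMeasurable_mul_of_bound (ℱ.le s) hZ (hM.integrable t) C
    (Filter.Eventually.of_forall hC)
  have h2 := integral_congr_ae (h.trans (Filter.EventuallyEq.rfl.mul (hM.condExp_ae_eq hst)))
  rw [integral_condExp] at h2
  simpa using h2

/-- A continuous solution of the integral equation `u' = -lam u` is exponential. -/
theorem eq_exp_mul_of_integral_eq {u : ℝ → ℝ} (hu : Continuous u) {s t lam : ℝ}
    (hst : s ≤ t) (h : ∀ r, s ≤ r → u r = u s - lam * ∫ x in s..r, u x) :
    u t = Real.exp (-lam * (t - s)) * u s := by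
  have hder : ∀ r, HasDerivAt (fun r => Real.exp (lam * r) * (u s - lam * ∫ x in s..r, u x))
      (Real.exp (lam * r) * lam * (u s - lam * ∫ x in s..r, u x) +
        Real.exp (lam * r) * (0 - lam * u r)) r := fun r => by
    have h1 : HasDerivAt (fun r => Real.exp (lam * r)) (Real.exp (lam * r) * lam) r := by
      simpa using ((hasDerivAt_id r).const_mul lam).exp
    have h2 : HasDerivAt (fun r => ∫ x in s..r, u x) (u r) r :=
      (hu.integral_hasStrictDerivAt s r).hasDerivAt
    exact h1.mul ((hasDerivAt_const r (u s)).sub (h2.const_mul lam))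
  have hconst := constant_of_has_deriv_right_zero (a := s) (b := t)
    (fun r _ => (hder r).continuousAt.continuousWithinAt) (fun r hr => by
      have h0 := (hder r).hasDerivWithinAt (s := Set.Ici r)
      rw [← h r hr.1] at h0
      convert h0 using 1
      ring) t (Set.right_mem_Icc.2 hst)
  simp only [intervalIntegral.integral_same, mul_zero, sub_zero] at hconst
  rw [← h t hst] at hconst
  have hexp : Real.exp (-lam * (t - s)) = Real.exp (-(lam * t)) * Real.exp (lam * s) := by
    rw [← Real.exp_add]
    ring_nf
  rw [hexp, mul_assoc, ← hconst, ← mul_assoc, ← Real.exp_add]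
  simp

theorem continuous_integral_coordProcess_mul {Q : Measure CirclePath} [IsFiniteMeasure Q]
    {Z : CirclePath → ℝ} (hZ : Integrable Z Q) (φ : C(UnitAddCircle, ℝ)) :
    Continuous fun r : ℝ => ∫ w, φ (coordProcess r.toNNReal w) * Z w ∂Q := by
  refine continuous_of_dominated (bound := fun w => ‖φ‖ * ‖Z w‖)
    (fun r => (integrable_comp_mul (measurable_coordProcess _) hZ φ).aestronglyMeasurable)
    (fun r => Filter.Eventually.of_forall fun w => ?_) (hZ.norm.const_mul _)
    (Filter.Eventually.of_forall fun w => ?_)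
  · rw [norm_mul]
    gcongr
    exact φ.norm_coe_le_norm _
  · exact (φ.continuous.comp (continuous_coordProcess_toNNReal w)).mul continuous_const

/-- Under a solution of the martingale problem, the expectation of an eigenfunction of `L` against
a weight from the past decays exponentially: the martingale property makes it a solution of a
linear differential equation in time. -/
theorem IsCircleBrownianLaw.integral_eigenfunction {x : UnitAddCircle} {Q : Measure CirclePath}
    (hQ : IsCircleBrownianLaw x Q) {lam : ℝ} {c : C(UnitAddCircle, ℝ)}
    (hc : IsGeneratorEigenfunction lam c) (s h : ℝ≥0) {Z : CirclePath → ℝ}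
    (hZ : StronglyMeasurable[pathFiltration s] Z) {C : ℝ} (hC : ∀ w, ‖Z w‖ ≤ C) :
    ∫ w, c (coordProcess (s + h) w) * Z w ∂Q =
      Real.exp (-lam * h) * ∫ w, c (coordProcess s w) * Z w ∂Q := by
  have := hQ.isProbabilityMeasure
  have hZm : AEStronglyMeasurable Z Q := (hZ.mono (pathFiltration.le s)).aestronglyMeasurable
  have hZi : Integrable Z Q := .of_bound hZm C (Filter.Eventually.of_forall hC)
  have hmart := hQ.martingale c hc.1
  have hpi : ∀ (t : ℝ≥0) (w : CirclePath), pathIntegral (circleGenerator c) t w =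
      -lam * ∫ r in (0 : ℝ)..t, c (coordProcess r.toNNReal w) := fun t w => by
    simp only [pathIntegral, hc.2, intervalIntegral.integral_const_mul]
  have hFub : ∀ t : ℝ, ∫ w, (∫ r in (s : ℝ)..t, c (coordProcess r.toNNReal w)) * Z w ∂Q =
      ∫ r in (s : ℝ)..t, ∫ w, c (coordProcess r.toNNReal w) * Z w ∂Q := fun t => by
    rw [intervalIntegral_integral_swap]
    · simp only [intervalIntegral.integral_mul_const]
    · have : IsFiniteMeasure (volume.restrict (Set.uIoc (s : ℝ) t)) :=
        ⟨by simp [Set.uIoc]⟩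
      have h1 : Integrable (fun p : ℝ × CirclePath => Z p.2)
          ((volume.restrict (Set.uIoc (s : ℝ) t)).prod Q) := hZi.comp_snd _
      exact h1.bdd_mul (c := ‖c‖)
        (stronglyMeasurable_uncurry_coordProcess c).aestronglyMeasurable
        (Filter.Eventually.of_forall fun p => c.norm_coe_le_norm _)
  have key := eq_exp_mul_of_integral_eq 
    (u := fun r : ℝ => ∫ w, c (coordProcess r.toNNReal w) * Z w ∂Q)
    (continuous_integral_coordProcess_mul hZi c) (s := s) (t := (s + h : ℝ≥0)) (lam := lam)
    (by simp) ?_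
  · simpa using key
  · intro r hr
    lift r to ℝ≥0 using s.2.trans hr
    have hr' : s ≤ r := hr
    have hm := hmart.integral_mul_eq hr' hZ hC
    have hmi : ∀ t, Integrable (fun w => Z w * (c (coordProcess t w) - c (coordProcess 0 w) -
        pathIntegral (circleGenerator c) t w)) Q := fun t =>
      (hmart.integrable t).bdd_mul (c := C) hZm (Filter.Eventually.of_forall hC)
    rw [← sub_eq_zero, ← integral_sub (hmi r) (hmi s)] at hm
    rw [← hFub, ← integral_const_mul, Real.toNNReal_coe, Real.toNNReal_coe, ← sub_eq_zero, ← hm]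
    have i1 := integrable_comp_mul (measurable_coordProcess r) hZi c
    have i2 := integrable_comp_mul (measurable_coordProcess s) hZi c
    have e : ∀ w, lam * ((∫ r in (s : ℝ)..r, c (coordProcess r.toNNReal w)) * Z w) =
        (Z w * (c (coordProcess r w) - c (coordProcess 0 w) -
          pathIntegral (circleGenerator c) r w) - Z w * (c (coordProcess s w) -
          c (coordProcess 0 w) - pathIntegral (circleGenerator c) s w)) -
        (c (coordProcess r w) * Z w - c (coordProcess s w) * Z w) := fun w => by
      rw [hpi, hpi, ← intervalIntegral.integral_interval_sub_left
        (intervalIntegrable_coordProcess c w 0 r) (intervalIntegrable_coordProcess c w 0 s)]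
      ring
    simp_rw [e]
    have h3 := integral_sub ((hmi r).sub (hmi s)) (i1.sub i2)
    simp only [Pi.sub_apply] at h3
    rw [h3, integral_sub i1 i2]
    ring

/-! ### The transition operators -/

theorem integrable_comp_coordProcess {Q : Measure CirclePath} [IsFiniteMeasure Q] (h : ℝ≥0)
    (φ : C(UnitAddCircle, ℝ)) : Integrable (fun w => φ (coordProcess h w)) Q := by
  simpa using integrable_comp_mul (measurable_coordProcess h) (integrable_const (μ := Q) (1 : ℝ)) φ

theorem IsCircleBrownianLaw.expectation_eigenfunction {x : UnitAddCircle} {Q : Measure CirclePath}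
    (hQ : IsCircleBrownianLaw x Q) {lam : ℝ} {c : C(UnitAddCircle, ℝ)}
    (hc : IsGeneratorEigenfunction lam c) (h : ℝ≥0) :
    ∫ w, c (coordProcess h w) ∂Q = Real.exp (-lam * h) * c x := by
  have := hQ.isProbabilityMeasure
  have key := hQ.integral_eigenfunction hc 0 h (Z := fun _ => 1) stronglyMeasurable_const
    (C := 1) (by simp)
  have h0 : ∫ w, c (coordProcess 0 w) ∂Q = c x := by
    have : (fun w => c (coordProcess 0 w)) =ᵐ[Q] fun _ => c x := by
      filter_upwards [hQ.start] with w hw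
      rw [hw]
    rw [integral_congr_ae this]
    simp
  simpa [h0] using key

/-- The Feller property: expectations of continuous functions of the path at a fixed time depend
continuously on the starting point. It holds for eigenfunctions of the generator, and passes to
uniform limits of their linear combinations. -/
theorem continuous_expectation_coordProcess {P : UnitAddCircle → Measure CirclePath}
    (hP : ∀ x, IsCircleBrownianLaw x (P x)) (h : ℝ≥0) (φ : C(UnitAddCircle, ℝ)) :
    Continuous fun x => ∫ w, φ (coordProcess h w) ∂P x := by
  have hprob : ∀ x, IsProbabilityMeasure (P x) := fun x => (hP x).isProbabilityMeasure
  have hspan : ∀ p ∈ Submodule.span ℝ {c : C(UnitAddCircle, ℝ) |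
      ∃ lam, IsGeneratorEigenfunction lam c},
      Continuous fun x => ∫ w, p (coordProcess h w) ∂P x := by
    intro p hp
    induction hp using Submodule.span_induction with
    | mem c hc =>
      obtain ⟨lam, hc⟩ := hc
      simp_rw [fun x => (hP x).expectation_eigenfunction hc h]
      exact continuous_const.mul c.continuous
    | zero => simpa using continuous_const
    | add p q _ _ hp hq =>
      simp_rw [ContinuousMap.add_apply, fun x => integral_add
        (integrable_comp_coordProcess (Q := P x) h p) (integrable_comp_coordProcess h q)]
      exact hp.add hq
    | smul a p _ hp =>
      simp_rw [ContinuousMap.smul_apply, smul_eq_mul, integral_const_mul]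
      exact continuous_const.mul hp
  refine continuous_of_uniform_approx_of_continuous fun U hU => ?_
  obtain ⟨ε, hε, hεU⟩ := Metric.mem_uniformity_dist.1 hU
  obtain ⟨p, hpφ, hp⟩ := Metric.dense_iff.1 dense_span_generatorEigenfunction φ (ε / 2) (half_pos hε)
  refine ⟨_, hspan p hp, fun x => hεU ?_⟩
  rw [Metric.mem_ball, dist_comm, dist_eq_norm] at hpφ
  rw [dist_eq_norm, ← integral_sub (integrable_comp_coordProcess h φ)
    (integrable_comp_coordProcess h p)]
  refine (norm_integral_le_of_norm_le_const (C := ε / 2)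
    (Filter.Eventually.of_forall fun w => ?_)).trans_lt ?_
  · exact ((φ - p).norm_coe_le_norm _).trans hpφ.le
  · simpa using hε

/-- The transition operator `φ ↦ (x ↦ E_x[φ(X_h)])` of Brownian motion on the circle, as a
contraction of the space of continuous functions. -/
noncomputable def transition {P : UnitAddCircle → Measure CirclePath}
    (hP : ∀ x, IsCircleBrownianLaw x (P x)) (h : ℝ≥0) :
    C(UnitAddCircle, ℝ) →L[ℝ] C(UnitAddCircle, ℝ) :=
  LinearMap.mkContinuous
    { toFun := fun φ => ⟨fun x => ∫ w, φ (coordProcess h w) ∂P x,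
        continuous_expectation_coordProcess hP h φ⟩
      map_add' := fun φ ψ => by
        ext x
        have := (hP x).isProbabilityMeasure
        exact integral_add (integrable_comp_coordProcess h φ) (integrable_comp_coordProcess h ψ)
      map_smul' := fun a φ => by
        ext x
        exact integral_const_mul _ _ }
    1 fun φ => by
      rw [one_mul]
      refine (ContinuousMap.norm_le _ (norm_nonneg _)).2 fun x => ?_
      have := (hP x).isProbabilityMeasure
      simpa using norm_integral_le_of_norm_le_const (μ := P x)
        (Filter.Eventually.of_forall fun w => φ.norm_coe_le_norm (coordProcess h w))

section

variable {P : UnitAddCircle → Measure CirclePath} (hP : ∀ x, IsCircleBrownianLaw x (P x))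

theorem transition_eigenfunction {lam : ℝ} {c : C(UnitAddCircle, ℝ)}
    (hc : IsGeneratorEigenfunction lam c) (h : ℝ≥0) :
    transition hP h c = Real.exp (-lam * h) • c := by
  ext x
  exact (hP x).expectation_eigenfunction hc h

/-- The Markov property at a fixed time, against a bounded weight from the past. -/
theorem integral_coordProcess_add_mul (x : UnitAddCircle) (s h : ℝ≥0) {Z : CirclePath → ℝ}
    (hZ : StronglyMeasurable[pathFiltration s] Z) {C : ℝ} (hC : ∀ w, ‖Z w‖ ≤ C)
    (φ : C(UnitAddCircle, ℝ)) :
    ∫ w, φ (coordProcess (s + h) w) * Z w ∂P x =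
      ∫ w, transition hP h φ (coordProcess s w) * Z w ∂P x := by
  have := (hP x).isProbabilityMeasure
  have hZi : Integrable Z (P x) := .of_bound (hZ.mono (pathFiltration.le s)).aestronglyMeasurable
    C (Filter.Eventually.of_forall hC)
  have key : weightedExpectation (P x) _ (measurable_coordProcess (s + h)) Z hZi =
      (weightedExpectation (P x) _ (measurable_coordProcess s) Z hZi).comp (transition hP h) :=
    ContinuousLinearMap.ext_generatorEigenfunction fun lam c hc => by
      simp [transition_eigenfunction hP hc, (hP x).integral_eigenfunction hc s h hZ hC]
  exact DFunLike.congr_fun key φ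

/-- Eigenfunctions of `L` for different eigenvalues are orthogonal in `L²(μ)`. -/
theorem GeneratorSelfAdjoint.integral_eigenfunction_mul {μ : Measure UnitAddCircle}
    (hμ : GeneratorSelfAdjoint μ) {lam nu : ℝ} {c d : C(UnitAddCircle, ℝ)}
    (hc : IsGeneratorEigenfunction lam c) (hd : IsGeneratorEigenfunction nu d) (hne : lam ≠ nu) :
    ∫ x, c x * d x ∂μ = 0 := by
  have h := hμ c d hc.1 hd.1
  simp only [hc.2, hd.2, mul_assoc, mul_left_comm _ (-nu), integral_const_mul] at h
  have h2 : (lam - nu) * ∫ x, c x * d x ∂μ = 0 := by linear_combination -h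
  exact (mul_eq_zero.1 h2).resolve_left (sub_ne_zero.2 hne)

/-- The transition operators inherit the symmetry in `L²(μ)` of the generator: by density this is
the orthogonality of eigenfunctions for different eigenvalues. -/
theorem integral_transition_mul {μ : Measure UnitAddCircle} [IsFiniteMeasure μ]
    (hμ : GeneratorSelfAdjoint μ) (h : ℝ≥0) (φ ψ : C(UnitAddCircle, ℝ)) :
    ∫ x, transition hP h φ x * ψ x ∂μ = ∫ x, φ x * transition hP h ψ x ∂μ := by
  have hi : ∀ χ : C(UnitAddCircle, ℝ), Integrable χ μ := fun χ => by
    simpa using integrable_comp_mul measurable_id (integrable_const (μ := μ) (1 : ℝ)) χ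
  have heig : ∀ lam c, IsGeneratorEigenfunction lam c → ∀ ψ : C(UnitAddCircle, ℝ),
      ∫ x, transition hP h c x * ψ x ∂μ = ∫ x, c x * transition hP h ψ x ∂μ := by
    intro lam c hc ψ
    have key : weightedExpectation μ id measurable_id _ (hi (transition hP h c)) =
        (weightedExpectation μ id measurable_id _ (hi c)).comp (transition hP h) :=
      ContinuousLinearMap.ext_generatorEigenfunction fun nu d hd => by
        simp only [weightedExpectation_apply, transition_eigenfunction hP hc,
          transition_eigenfunction hP hd, ContinuousLinearMap.comp_apply, id,
          ContinuousMap.smul_apply, smul_eq_mul, mul_assoc, mul_left_comm (d _), integral_const_mul]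
        rcases eq_or_ne lam nu with rfl | hne
        · rfl
        · rw [hμ.integral_eigenfunction_mul hd hc hne.symm, mul_zero, mul_zero]
    have := DFunLike.congr_fun key ψ
    simpa [mul_comm] using this
  have key : (weightedExpectation μ id measurable_id _ (hi ψ)).comp (transition hP h) =
      weightedExpectation μ id measurable_id _ (hi (transition hP h ψ)) :=
    ContinuousLinearMap.ext_generatorEigenfunction fun lam c hc => heig lam c hc ψ
  exact DFunLike.congr_fun key φ

end

/-! ### Discretised Feynman–Kac functionals -/

section

variable {P : UnitAddCircle → Measure CirclePath} (hP : ∀ x, IsCircleBrownianLaw x (P x))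

/-- One step of the discretised Feynman–Kac semigroup: multiplication by the weight `φ` after the
transition operator. -/
noncomputable def weightedStep (h : ℝ≥0) (φ ψ : C(UnitAddCircle, ℝ)) : C(UnitAddCircle, ℝ) :=
  φ * transition hP h ψ

/-- The expectation of a product of weights over an equidistant time grid is given by iterating the
weighted transition operator. -/
theorem integral_prod_coordProcess (x : UnitAddCircle) (h : ℝ≥0) (φ g f : C(UnitAddCircle, ℝ))
    (N : ℕ) :
    ∫ w, f (coordProcess (N * h) w) * (g (coordProcess 0 w) *
        ∏ k ∈ Finset.range (N + 1), φ (coordProcess (k * h) w)) ∂P x =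
      g x * ((weightedStep hP h φ)^[N] (φ * f)) x := by
  have := (hP x).isProbabilityMeasure
  induction N generalizing f with
  | zero =>
    have : (fun w => f (coordProcess (0 * h) w) * (g (coordProcess 0 w) *
        φ (coordProcess (0 * h) w))) =ᵐ[P x] fun _ => g x * (φ x * f x) := by
      filter_upwards [(hP x).start] with w hw
      rw [zero_mul, hw]
      ring
    simp only [zero_add, Finset.range_one, Finset.prod_singleton, Nat.cast_zero]
    rw [integral_congr_ae this]
    simp
  | succ N ih =>
    have hprod : StronglyMeasurable[pathFiltration (N * h)] fun w => g (coordProcess 0 w) *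
        ∏ k ∈ Finset.range (N + 1), φ (coordProcess (k * h) w) := by
      refine (stronglyMeasurable_pathFiltration_comp zero_le g).mul ?_
      refine Finset.stronglyMeasurable_fun_prod _ fun k hk => ?_
      refine stronglyMeasurable_pathFiltration_comp ?_ φ
      gcongr
      exact Nat.lt_succ_iff.1 (Finset.mem_range.1 hk)
    have hbound : ∀ w, ‖g (coordProcess 0 w) *
        ∏ k ∈ Finset.range (N + 1), φ (coordProcess (k * h) w)‖ ≤ ‖g‖ * ‖φ‖ ^ (N + 1) := by
      intro w
      rw [norm_mul, norm_prod]
      gcongr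
      · exact g.norm_coe_le_norm _
      · exact (Finset.prod_le_prod (fun _ _ => norm_nonneg _) fun k _ =>
          φ.norm_coe_le_norm _).trans_eq (by simp)
    have hmarkov := integral_coordProcess_add_mul hP x (N * h) h hprod hbound (φ * f)
    rw [ih] at hmarkov
    rw [Function.iterate_succ_apply]
    refine Eq.trans ?_ hmarkov
    congr 1 with w
    rw [Finset.prod_range_succ]
    simp only [ContinuousMap.mul_apply, Nat.cast_succ, add_mul, one_mul]
    ring

/-- The iterated weighted transition operators are symmetric in `L²(μ)`. -/
theorem integral_mul_iterate_weightedStep {μ : Measure UnitAddCircle} [IsFiniteMeasure μ]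
    (hμ : GeneratorSelfAdjoint μ) (h : ℝ≥0) (φ g f : C(UnitAddCircle, ℝ)) (N : ℕ) :
    ∫ x, g x * ((weightedStep hP h φ)^[N] (φ * f)) x ∂μ =
      ∫ x, f x * ((weightedStep hP h φ)^[N] (φ * g)) x ∂μ := by
  have key : ∀ (N : ℕ) (a b : C(UnitAddCircle, ℝ)),
      ∫ x, a x * ((weightedStep hP h φ)^[N] (φ * b)) x ∂μ =
        ∫ x, ((weightedStep hP h φ)^[N] (φ * a)) x * b x ∂μ := by
    intro N
    induction N with
    | zero =>
      intro a b
      simp [mul_left_comm, mul_assoc]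
    | succ N ih =>
      intro a b
      rw [Function.iterate_succ_apply, Function.iterate_succ_apply']
      have h1 := ih a (transition hP h (φ * b))
      have h2 := integral_transition_mul hP hμ h ((weightedStep hP h φ)^[N] (φ * a)) (φ * b)
      refine h1.trans (h2.symm.trans ?_)
      simp only [weightedStep, ContinuousMap.mul_apply]
      congr 1 with x
      ring
  rw [key]
  congr 1 with x
  ring

end

/-! ### Riemann sums -/

/-- Riemann sums with `n + 1` steps and both end points of the grid included, so that they are
symmetric under reversal of the grid, converge for continuous functions. -/
theorem tendsto_riemannSum {u : ℝ → ℝ} (hu : Continuous u) {t : ℝ} (ht : 0 ≤ t) :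
    Filter.Tendsto (fun n : ℕ => t / (n + 1) * ∑ k ∈ Finset.range (n + 2), u (k * (t / (n + 1))))
      Filter.atTop (nhds (∫ r in (0 : ℝ)..t, u r)) := by
  -- The grid point beyond the usual left-end-point sum contributes a vanishing amount.
  have hlast : Filter.Tendsto (fun n : ℕ => t / ((n : ℝ) + 1) * u t) Filter.atTop (nhds 0) := by
    simpa using (tendsto_const_div_atTop_nhds_zero_nat t).comp (Filter.tendsto_add_atTop_nat 1)
      |>.mul_const (u t)
  have hmain : Filter.Tendsto
      (fun n : ℕ => t / (n + 1) * ∑ k ∈ Finset.range (n + 1), u (k * (t / (n + 1))))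
      Filter.atTop (nhds (∫ r in (0 : ℝ)..t, u r)) := by
    refine Metric.tendsto_atTop.2 fun ε hε => ?_
    have huc := isCompact_Icc.uniformContinuousOn_of_continuous (s := Set.Icc 0 t) hu.continuousOn
    obtain ⟨δ, hδ, hδu⟩ := Metric.uniformContinuousOn_iff.1 huc (ε / (t + 1)) (by positivity)
    obtain ⟨n₀, hn₀⟩ := exists_nat_gt (t / δ)
    refine ⟨n₀, fun n hn => ?_⟩
    have hn1 : (0 : ℝ) < n + 1 := by positivity
    set h := t / ((n : ℝ) + 1) with hh
    have hh0 : 0 ≤ h := by positivity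
    have hhδ : h < δ := by
      rw [hh, div_lt_comm₀ hn1 hδ]
      have : (n₀ : ℝ) ≤ n := by exact_mod_cast hn
      linarith
    have hend : ((n + 1 : ℕ) : ℝ) * h = t := by
      rw [hh]
      push_cast
      field_simp
    have hint : ∫ r in (0 : ℝ)..t, u r =
        ∑ k ∈ Finset.range (n + 1), ∫ r in (k * h)..((k + 1 : ℕ) * h), u r := by
      rw [intervalIntegral.sum_integral_adjacent_intervals (a := fun k : ℕ => k * h)
        fun k _ => hu.intervalIntegrable _ _, hend]
      simp
    have hterm : ∀ k ∈ Finset.range (n + 1),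
        ‖h * u (k * h) - ∫ r in (k * h)..((k + 1 : ℕ) * h), u r‖ ≤ ε / (t + 1) * h := by
      intro k hk
      have hkn : ((k + 1 : ℕ) : ℝ) * h ≤ t := by
        rw [← hend]
        gcongr
        exact Nat.lt_succ_iff.1 (Finset.mem_range.1 hk)
      have hlen : ((k + 1 : ℕ) : ℝ) * h - k * h = h := by
        push_cast
        ring
      have hk0 : 0 ≤ (k : ℝ) * h := by positivity
      have hc : h * u (k * h) = ∫ r in (k * h)..((k + 1 : ℕ) * h), u (k * h) := by
        rw [intervalIntegral.integral_const, hlen, smul_eq_mul]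
      rw [hc, ← intervalIntegral.integral_sub intervalIntegrable_const (hu.intervalIntegrable _ _)]
      refine (intervalIntegral.norm_integral_le_of_norm_le_const
        (C := ε / (t + 1)) fun r hr => ?_).trans_eq ?_
      · rw [Set.uIoc_of_le (by linarith)] at hr
        rw [← dist_eq_norm]
        refine (hδu _ ⟨hk0, by linarith⟩ _ ⟨by linarith [hr.1], hr.2.trans hkn⟩ ?_).le
        rw [dist_comm, Real.dist_eq, abs_of_nonneg] <;> linarith [hr.1, hr.2]
      · rw [hlen, abs_of_nonneg hh0]
    rw [dist_eq_norm, hint, Finset.mul_sum, ← Finset.sum_sub_distrib]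
    calc _ ≤ ∑ k ∈ Finset.range (n + 1), ε / (t + 1) * h := norm_sum_le_of_le _ hterm
      _ = ε / (t + 1) * t := by
        rw [Finset.sum_const, Finset.card_range, nsmul_eq_mul, mul_left_comm, hend]
      _ < ε := by
        rw [div_mul_eq_mul_div, div_lt_iff₀ (by linarith)]
        nlinarith
  have hsum := hmain.add hlast
  rw [add_zero] at hsum
  refine hsum.congr fun n => ?_
  have hn1 : (n : ℝ) + 1 ≠ 0 := by positivity
  rw [Finset.sum_range_succ _ (n + 1), mul_add]
  congr 3
  push_cast
  field_simp

/-! ### Passage to the limit -/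

/-- The Riemann sum for `pathIntegral V t` on the grid of mesh `t / (n + 1)`, both end points
included. -/
noncomputable def pathRiemannSum (V : UnitAddCircle → ℝ) (t : ℝ≥0) (n : ℕ) (w : CirclePath) : ℝ :=
  t / (n + 1) * ∑ k ∈ Finset.range (n + 2), V (coordProcess (k * (t / (n + 1))) w)

theorem tendsto_pathRiemannSum (V : C(UnitAddCircle, ℝ)) (t : ℝ≥0) (w : CirclePath) :
    Filter.Tendsto (fun n => pathRiemannSum V t n w) Filter.atTop (nhds (pathIntegral V t w)) := by
  refine (tendsto_riemannSum (V.continuous.comp (continuous_coordProcess_toNNReal w)) t.2).congr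
    fun n => ?_
  unfold pathRiemannSum
  congr 1
  refine Finset.sum_congr rfl fun k _ => ?_
  have : (k : ℝ) * (t / (n + 1)) = ((k * (t / (n + 1)) : ℝ≥0) : ℝ) := by push_cast; rfl
  simp only [Function.comp_apply, NNReal.val_eq_coe]
  rw [this, Real.toNNReal_coe]

theorem measurable_pathRiemannSum (V : C(UnitAddCircle, ℝ)) (t : ℝ≥0) (n : ℕ) :
    Measurable (pathRiemannSum V t n) :=
  (Finset.measurable_fun_sum _ fun _ _ =>
    V.continuous.measurable.comp (measurable_coordProcess _)).const_mul _

theorem pathRiemannSum_le (V : C(UnitAddCircle, ℝ)) (t : ℝ≥0) (n : ℕ) (w : CirclePath) :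
    pathRiemannSum V t n w ≤ 2 * t * ‖V‖ := by
  have hsum : ∑ k ∈ Finset.range (n + 2), V (coordProcess (k * (t / (n + 1))) w) ≤
      (n + 2) * ‖V‖ := by
    refine (Finset.sum_le_card_nsmul _ _ ‖V‖ fun k _ =>
      (le_abs_self _).trans (V.norm_coe_le_norm _)).trans_eq ?_
    simp
  calc pathRiemannSum V t n w ≤ t / (n + 1) * ((n + 2) * ‖V‖) := by
        unfold pathRiemannSum
        gcongr
    _ = ((n + 2) / (n + 1)) * (t * ‖V‖) := by ring
    _ ≤ 2 * (t * ‖V‖) := by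
        gcongr
        rw [div_le_iff₀ (by positivity)]
        linarith [(Nat.cast_nonneg n : (0 : ℝ) ≤ n)]
    _ = 2 * t * ‖V‖ := by ring

section

variable (V f g : C(UnitAddCircle, ℝ)) (t : ℝ≥0)

theorem norm_exp_pathRiemannSum_mul_le (n : ℕ) (w : CirclePath) :
    ‖Real.exp (pathRiemannSum V t n w) * f (coordProcess t w) * g (coordProcess 0 w)‖ ≤
      Real.exp (2 * t * ‖V‖) * ‖f‖ * ‖g‖ := by
  rw [norm_mul, norm_mul, Real.norm_of_nonneg (Real.exp_nonneg _)]
  gcongr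
  · exact pathRiemannSum_le V t n w
  · exact f.norm_coe_le_norm _
  · exact g.norm_coe_le_norm _

theorem measurable_exp_pathRiemannSum_mul (n : ℕ) : Measurable fun w =>
    Real.exp (pathRiemannSum V t n w) * f (coordProcess t w) * g (coordProcess 0 w) :=
  ((measurable_pathRiemannSum V t n).exp.mul
    (f.continuous.measurable.comp (measurable_coordProcess t))).mul
    (g.continuous.measurable.comp (measurable_coordProcess 0))

theorem tendsto_exp_pathRiemannSum_mul (w : CirclePath) : Filter.Tendsto
    (fun n => Real.exp (pathRiemannSum V t n w) * f (coordProcess t w) * g (coordProcess 0 w))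
    Filter.atTop
    (nhds (Real.exp (pathIntegral V t w) * f (coordProcess t w) * g (coordProcess 0 w))) :=
  (((Real.continuous_exp.tendsto _).comp (tendsto_pathRiemannSum V t w)).mul_const _).mul_const _

theorem integrable_exp_pathRiemannSum_mul (Q : Measure CirclePath) [IsFiniteMeasure Q] (n : ℕ) :
    Integrable (fun w =>
      Real.exp (pathRiemannSum V t n w) * f (coordProcess t w) * g (coordProcess 0 w)) Q :=
  .of_bound (measurable_exp_pathRiemannSum_mul V f g t n).aestronglyMeasurable _
    (Filter.Eventually.of_forall (norm_exp_pathRiemannSum_mul_le V f g t n))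

theorem integrable_exp_pathIntegral_mul (Q : Measure CirclePath) [IsFiniteMeasure Q] :
    Integrable (fun w =>
      Real.exp (pathIntegral V t w) * f (coordProcess t w) * g (coordProcess 0 w)) Q :=
  .of_bound (measurable_of_tendsto_metrizable (measurable_exp_pathRiemannSum_mul V f g t)
      (tendsto_pi_nhds.2 (tendsto_exp_pathRiemannSum_mul V f g t))).aestronglyMeasurable _
    (Filter.Eventually.of_forall fun w =>
      le_of_tendsto' (tendsto_exp_pathRiemannSum_mul V f g t w).norm fun n =>
        norm_exp_pathRiemannSum_mul_le V f g t n w)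

theorem tendsto_integral_exp_pathRiemannSum_mul (Q : Measure CirclePath) [IsFiniteMeasure Q] :
    Filter.Tendsto (fun n => ∫ w,
        Real.exp (pathRiemannSum V t n w) * f (coordProcess t w) * g (coordProcess 0 w) ∂Q)
      Filter.atTop (nhds (∫ w,
        Real.exp (pathIntegral V t w) * f (coordProcess t w) * g (coordProcess 0 w) ∂Q)) :=
  tendsto_integral_of_dominated_convergence (fun _ => Real.exp (2 * t * ‖V‖) * ‖f‖ * ‖g‖)
    (fun n => (measurable_exp_pathRiemannSum_mul V f g t n).aestronglyMeasurable)
    (integrable_const _)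
    (fun n => Filter.Eventually.of_forall (norm_exp_pathRiemannSum_mul_le V f g t n))
    (Filter.Eventually.of_forall (tendsto_exp_pathRiemannSum_mul V f g t))

end

theorem MeasureTheory.integral_measure_bind {α β : Type*} [MeasurableSpace α] [MeasurableSpace β]
    (μ : Measure α) [SFinite μ] (κ : Kernel α β) [IsSFiniteKernel κ] {F : β → ℝ}
    (hF : Integrable F (μ.bind κ)) :
    ∫ w, F w ∂(μ.bind κ) = ∫ x, ∫ w, F w ∂κ x ∂μ := by
  rw [← Measure.snd_compProd, Measure.snd] at hF ⊢
  rw [integral_map measurable_snd.aemeasurable hF.aestronglyMeasurable]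
  exact Measure.integral_compProd (hF.comp_measurable measurable_snd)

/-- The discretised Feynman–Kac functional is symmetric under the path measure started from `μ`. -/
theorem integral_exp_pathRiemannSum_mul_comm {μ : Measure UnitAddCircle} [IsFiniteMeasure μ]
    (hμ : GeneratorSelfAdjoint μ) {P : Kernel UnitAddCircle CirclePath} [IsMarkovKernel P]
    (hP : ∀ x, IsCircleBrownianLaw x (P x)) (V f g : C(UnitAddCircle, ℝ)) (t : ℝ≥0) (n : ℕ) :
    ∫ w, Real.exp (pathRiemannSum V t n w) * f (coordProcess t w) * g (coordProcess 0 w)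
        ∂(μ.bind P) =
      ∫ w, Real.exp (pathRiemannSum V t n w) * g (coordProcess t w) * f (coordProcess 0 w)
        ∂(μ.bind P) := by
  have hfin : IsFiniteMeasure (μ.bind P) := inferInstance
  set h : ℝ≥0 := t / (n + 1) with hh
  let φ : C(UnitAddCircle, ℝ) := ⟨fun y => Real.exp (h * V y), by fun_prop⟩
  have key : ∀ a b : C(UnitAddCircle, ℝ),
      ∫ w, Real.exp (pathRiemannSum V t n w) * a (coordProcess t w) * b (coordProcess 0 w)
        ∂(μ.bind P) = ∫ x, b x * ((weightedStep hP h φ)^[n + 1] (φ * a)) x ∂μ := by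
    intro a b
    rw [integral_measure_bind _ _ (integrable_exp_pathRiemannSum_mul V a b t _ n)]
    congr 1 with x
    rw [← integral_prod_coordProcess hP x h φ b a (n + 1)]
    congr 1 with w
    have hend : ((n + 1 : ℕ) : ℝ≥0) * h = t := by
      rw [hh]
      push_cast
      field_simp
    have hexp : Real.exp (pathRiemannSum V t n w) =
        ∏ k ∈ Finset.range (n + 1 + 1), φ (coordProcess (k * h) w) := by
      simp only [pathRiemannSum, φ, ContinuousMap.coe_mk, ← Real.exp_sum, ← Finset.mul_sum, hh]
      push_cast
      rfl
    rw [hend, hexp]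
    ring
  rw [key, key, integral_mul_iterate_weightedStep hP hμ]

/-- `P x` is the law of Brownian motion on the circle started at `x`, and `μ.bind P` is the path
measure `A ↦ ∫ P x A dμ(x)` with initial measure `μ`. -/
theorem mainTheorem4
    (μ : Measure UnitAddCircle) [IsFiniteMeasure μ]
    (hμ : GeneratorSelfAdjoint μ)
    (P : Kernel UnitAddCircle CirclePath)
    (hP : ∀ x, IsCircleBrownianLaw x (P x))
    (V : UnitAddCircle → ℝ) (K : ℝ≥0) (hV : LipschitzWith K V)
    (t : ℝ≥0) (f g : UnitAddCircle → ℝ) (hf : Continuous f) (hg : Continuous g) :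
    Integrable (fun w : CirclePath =>
        Real.exp (pathIntegral V t w) * f (coordProcess t w) * g (coordProcess 0 w))
      (μ.bind P) ∧
    Integrable (fun w : CirclePath =>
        Real.exp (pathIntegral V t w) * f (coordProcess 0 w) * g (coordProcess t w))
      (μ.bind P) ∧
    ∫ w, Real.exp (pathIntegral V t w) * f (coordProcess t w) * g (coordProcess 0 w)
        ∂(μ.bind P) =
      ∫ w, Real.exp (pathIntegral V t w) * f (coordProcess 0 w) * g (coordProcess t w)
        ∂(μ.bind P) := by
  have hprob : IsMarkovKernel P := ⟨fun x => (hP x).isProbabilityMeasure⟩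
  have hfin : IsFiniteMeasure (μ.bind P) := inferInstance
  let V' : C(UnitAddCircle, ℝ) := ⟨V, hV.continuous⟩
  let f' : C(UnitAddCircle, ℝ) := ⟨f, hf⟩
  let g' : C(UnitAddCircle, ℝ) := ⟨g, hg⟩
  have hswap : (fun w : CirclePath =>
      Real.exp (pathIntegral V t w) * f (coordProcess 0 w) * g (coordProcess t w)) = fun w =>
      Real.exp (pathIntegral V t w) * g (coordProcess t w) * f (coordProcess 0 w) := by
    funext w
    ring
  rw [hswap]
  refine ⟨integrable_exp_pathIntegral_mul V' f' g' t _,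
    integrable_exp_pathIntegral_mul V' g' f' t _, ?_⟩
  refine tendsto_nhds_unique (tendsto_integral_exp_pathRiemannSum_mul V' f' g' t (μ.bind P)) ?_
  simp_rw [integral_exp_pathRiemannSum_mul_comm hμ hP V' f' g' t]
  exact tendsto_integral_exp_pathRiemannSum_mul V' g' f' t (μ.bind P)
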